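/- **Proposition 3.1 (Decomposition in subproblems).** Let $0<\rho_1<\rho_2<\rho_3<1$, let $T\ge 0$ be an integer and put $M=\lfloor T\rho_2\rfloor$. Attach to the sites of $\mathbb Z$ independent Poisson clocks of rate $1$. In TASEP, when the clock at a site $z$ rings, the particle at $z$ (if there is one) jumps to $z+1$, provided that $z+1$ is empty (graphical construction: the position of a particle at time $t$ is the limit as $L\to\infty$ of its position when only the first $L$ rings of the clocks at the sites in $[-L,L]$ are used). Let $x_n(t)$, $x^1_n(t)$, $x^2_n(t)$, $x^3_n(t)$ denote the position at time $t$ of the particle with label $n$ in four TASEPs, all driven by the same clocks (basic coupling), with the initial conditions $$x_n(0)=\begin{cases}-\lfloor n/\rho_1\rfloor, & n\ge 0,\\ -\lfloor n/\rho_2\rfloor, & -M\le n\le -1,\\ T-\lfloor (n+M)/\rho_3\rfloor, & n<-M,\end{cases}$$ $$x^1_n(0)=-\lfloor n/\rho_1\rfloor \ \text{ for } n\ge 0 \quad\text{(no particles with } n<0),$$ $$x^2_n(0)=\begin{cases}-n, & n\ge 0,\\ -\lfloor n/\rho_2\rfloor, & -M\le n\le -1,\end{cases}\quad\text{(no particles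 with } n<-M),$$ $$x^3_n(0)=\begin{cases}T-(n+M), & n\ge -M,\\ T-\lfloor (n+M)/\rho_3\rfloor, & n<-M.\end{cases}$$ Then, almost surely, the four processes are well defined (for all $t\ge 0$ and every label $n$, the approximations of the position of particle $n$ at time $t$ are eventually constant in $L$), and for all $t\ge 0$ and all integers $N>0$, $$x_N(t)=\min\{x^1_N(t),\,x^2_N(t),\,x^3_N(t)\}.$$ -/

import Mathlib

open Filter MeasureTheory ProbabilityTheory

/-! ### The graphical construction of TASEP

A clock is attached to every site `z : ℤ`; `e z k` is the waiting time between the `k`-th and the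
`(k+1)`-st ring of the clock at `z` (the first ring happens at time `e z 0`).  Particles carry labels
`n` in a set `I ⊆ ℤ` and are ordered from right to left; `x n` is the position of particle `n`
(the value `x n` is irrelevant for `n ∉ I`). -/

/-- The time of the `k`-th ring (`k = 0, 1, …`) of the clock at site `z`. -/
noncomputable def ringTime (e : ℤ → ℕ → ℝ) (z : ℤ) (k : ℕ) : ℝ :=
  ∑ i ∈ Finset.range (k + 1), e z i

open Classical in
/-- The effect of a ring of the clock at site `z`: the particle at `z`, if there is one, jumps
to `z + 1`, provided that no particle occupies `z + 1`. -/
noncomputable def ringUpdate (I : Set ℤ) (x : ℤ → ℤ) (z : ℤ) : ℤ → ℤ := fun n =>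
  if n ∈ I ∧ x n = z ∧ ∀ m ∈ I, x m ≠ z + 1 then x n + 1 else x n

open Classical in
/-- The rings up to time `t` that are among the first `L` rings of the clock of a site in `[-L, L]`,
as pairs (time, site).  The lexicographic order on these pairs is the order in time (for Poisson
clocks, there are almost surely no two rings at the same time). -/
noncomputable def ringsUpTo (e : ℤ → ℕ → ℝ) (L : ℕ) (t : ℝ) : Finset (ℝ ×ₗ ℤ) :=
  ((Finset.Icc (-(L : ℤ)) (L : ℤ) ×ˢ Finset.range L).filter
    (fun p => ringTime e p.1 p.2 ≤ t)).image (fun p => toLex (ringTime e p.1 p.2, p.1))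

/-- Positions at time `t` when only the first `L` rings of the clocks at the sites in `[-L, L]` are
used: these finitely many rings are carried out one after the other, in the order of their times,
starting from the initial configuration `x₀`. -/
noncomputable def tasepApprox (e : ℤ → ℕ → ℝ) (I : Set ℤ) (x₀ : ℤ → ℤ) (L : ℕ) (t : ℝ) : ℤ → ℤ :=
  (((ringsUpTo e L t).sort (· ≤ ·)).map (fun r => (ofLex r).2)).foldl (ringUpdate I) x₀

/-- `tasep e I x₀ n t` is the position at time `t` of particle `n` in the TASEP with labels `I` and
initial configuration `x₀` that is driven by the clocks `e`: the limit `L → ∞` of `tasepApprox`. -/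
noncomputable def tasep (e : ℤ → ℕ → ℝ) (I : Set ℤ) (x₀ : ℤ → ℤ) (n : ℤ) (t : ℝ) : ℤ :=
  limUnder atTop (fun L : ℕ => tasepApprox e I x₀ L t n)

/-- The graphical construction with the clocks `e` is well defined for the labels `I` and the initial
configuration `x₀`: at all times, the position of every particle depends on finitely many rings only,
that is, it is the eventually constant value of the approximations. -/
def TasepWellDefined (e : ℤ → ℕ → ℝ) (I : Set ℤ) (x₀ : ℤ → ℤ) : Prop :=
  ∀ t : ℝ, 0 ≤ t → ∀ n ∈ I, ∀ᶠ L : ℕ in atTop, tasepApprox e I x₀ L t n = tasep e I x₀ n t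

/-- The clocks with waiting times `E` are independent Poisson clocks of rate one: all waiting times
are independent and exponentially distributed with parameter one. -/
structure IsPoissonClocks {Ω : Type*} [MeasurableSpace Ω] (P : Measure Ω)
    (E : ℤ → ℕ → Ω → ℝ) : Prop where
  hasLaw : ∀ z k, HasLaw (E z k) (expMeasure 1) P
  indep : iIndepFun (fun p : ℤ × ℕ => E p.1 p.2) P

/-! ### The initial conditions -/

/-- `⌊T ρ₂⌋`; the particles initially in `(0, T]` are those with labels `-⌊T ρ₂⌋, …, -1`. -/
noncomputable def midCount (ρ₂ : ℝ) (T : ℕ) : ℤ := ⌊(T : ℝ) * ρ₂⌋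

/-- The initial condition with the three densities `ρ₁, ρ₂, ρ₃`; the labels are all of `ℤ`. -/
noncomputable def threeDensityInit (ρ₁ ρ₂ ρ₃ : ℝ) (T : ℕ) (n : ℤ) : ℤ :=
  if 0 ≤ n then -⌊(n : ℝ) / ρ₁⌋
  else if -midCount ρ₂ T ≤ n then -⌊(n : ℝ) / ρ₂⌋
  else (T : ℤ) - ⌊((n + midCount ρ₂ T : ℤ) : ℝ) / ρ₃⌋

/-- All particles to the right of the origin are removed; the labels are `n ≥ 0`. -/
noncomputable def init₁ (ρ₁ : ℝ) (n : ℤ) : ℤ := -⌊(n : ℝ) / ρ₁⌋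

/-- All particles to the right of `T` are removed and the particles to the left of the origin are
packed into a step; the labels are `n ≥ -⌊T ρ₂⌋`. -/
noncomputable def init₂ (ρ₂ : ℝ) (n : ℤ) : ℤ :=
  if 0 ≤ n then -n else -⌊(n : ℝ) / ρ₂⌋

/-- All particles to the left of `T` are packed into a step; the labels are all of `ℤ`. -/
noncomputable def init₃ (ρ₂ ρ₃ : ℝ) (T : ℕ) (n : ℤ) : ℤ :=
  if -midCount ρ₂ T ≤ n then (T : ℤ) - (n + midCount ρ₂ T)
  else (T : ℤ) - ⌊((n + midCount ρ₂ T : ℤ) : ℝ) / ρ₃⌋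

/-! In the basic coupling a single ring preserves the relation "`x` is the minimum of the `y i`"
(`IsMinOf.step`). If particle `n` of `x` is free to jump, so is every copy of it at the same site;
if it is blocked by `m`, the system attaining the minimum at `m` has its particle `n` blocked at the
same site. By induction the relation survives any finite list of rings. For infinitely many clocks,
a site `b` to the right of particle `n` whose clock is silent up to time `t` screens off everything
beyond it. Thus only the finitely many rings between the start of `n` and `b` matter
(`foldl_ringUpdate_filter`), and the minimum passes to the limit. Independence yields such sites
almost surely. At time 0, each subproblem equals `x` on its own block of labels and lies weakly
above it elsewhere. -/

/-- Particles with smaller labels are strictly to the right of particles with larger labels. -/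
def OrderedOn (I : Set ℤ) (x : ℤ → ℤ) : Prop :=
  StrictAntiOn x I

lemma le_ringUpdate (I : Set ℤ) (x : ℤ → ℤ) (z n : ℤ) : x n ≤ ringUpdate I x z n := by
  unfold ringUpdate
  split_ifs <;> omega

lemma ringUpdate_of_ne {I : Set ℤ} {x : ℤ → ℤ} {z n : ℤ} (h : x n ≠ z) :
    ringUpdate I x z n = x n := by
  unfold ringUpdate
  rw [if_neg]
  tauto

lemma ringUpdate_of_empty {I : Set ℤ} {x : ℤ → ℤ} {z n : ℤ} (hn : n ∈ I) (h : x n = z)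
    (he : ∀ m ∈ I, x m ≠ z + 1) : ringUpdate I x z n = z + 1 := by
  unfold ringUpdate
  rw [if_pos ⟨hn, h, he⟩, h]

lemma ringUpdate_of_occupied {I : Set ℤ} {x : ℤ → ℤ} {z n m : ℤ} (hm : m ∈ I)
    (h : x m = z + 1) : ringUpdate I x z n = x n := by
  unfold ringUpdate
  rw [if_neg]
  rintro ⟨-, -, he⟩
  exact he m hm h

lemma OrderedOn.step {I : Set ℤ} {x : ℤ → ℤ} (h : OrderedOn I x) (z : ℤ) :
    OrderedOn I (ringUpdate I x z) := by
  intro m hm n hn hmn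
  have hlt := h hm hn hmn
  have hle := le_ringUpdate I x z m
  by_cases hz : x n = z
  · by_cases he : ∀ k ∈ I, x k ≠ z + 1
    · rw [ringUpdate_of_empty hn hz he]
      have := he m hm
      omega
    · push Not at he
      obtain ⟨k, hk, hkz⟩ := he
      rw [ringUpdate_of_occupied hk hkz, ringUpdate_of_occupied hk hkz]
      exact hlt
  · rw [ringUpdate_of_ne hz]
    omega

/-- `x` is the pointwise minimum of the configurations `y i`, where `y i n` only counts if the
label `n` is present in `I i`. -/
def IsMinOf {ι : Type*} (I : ι → Set ℤ) (y : ι → ℤ → ℤ) (x : ℤ → ℤ) : Prop :=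
  ∀ n, (∀ i, n ∈ I i → x n ≤ y i n) ∧ ∃ i, n ∈ I i ∧ y i n = x n

lemma IsMinOf.step {ι : Type*} {I : ι → Set ℤ} {y : ι → ℤ → ℤ} {x : ℤ → ℤ}
    (h : IsMinOf I y x) (hI : ∀ i, IsUpperSet (I i)) (hx : OrderedOn Set.univ x)
    (hy : ∀ i, OrderedOn (I i) (y i)) (z : ℤ) :
    IsMinOf I (fun i => ringUpdate (I i) (y i) z) (ringUpdate Set.univ x z) := by
  intro n
  obtain ⟨hle, j, hj, hjn⟩ := h n
  by_cases hz : x n = z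
  · by_cases he : ∀ m ∈ Set.univ, x m ≠ z + 1
    · rw [ringUpdate_of_empty (Set.mem_univ n) hz he]
      -- A blocker `m < n` in system `i` would give `z < x m ≤ y i m = z + 1`, so `x m` would occupy
      -- the empty site.
      have hmove : ∀ i, n ∈ I i → y i n = z → ringUpdate (I i) (y i) z n = z + 1 := by
        intro i hi hin
        refine ringUpdate_of_empty hi hin fun m hm hmz => ?_
        have hmn : m < n := by
          by_contra hnm
          have := (hy i).antitoneOn hi hm (not_lt.mp hnm)
          omega
        have h1 := hx (Set.mem_univ m) (Set.mem_univ n) hmn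
        have h2 := (h m).1 i hm
        have h3 := he m (Set.mem_univ m)
        omega
      refine ⟨fun i hi => ?_, j, hj, hmove j hj (hjn.trans hz)⟩
      by_cases hin : y i n = z
      · exact (hmove i hi hin).ge
      · change z + 1 ≤ ringUpdate (I i) (y i) z n
        rw [ringUpdate_of_ne hin]
        have := hle i hi
        omega
    · push Not at he
      obtain ⟨m, hm, hmz⟩ := he
      rw [ringUpdate_of_occupied hm hmz]
      refine ⟨fun i hi => (hle i hi).trans (le_ringUpdate _ _ _ _), ?_⟩
      -- The system minimal at the blocker `m` also contains `n`, its labels being an upper set.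
      -- Order forces `y i n ≤ z`, hence equality with `x n`, and the jump is blocked there too.
      obtain ⟨-, i, hi, him⟩ := h m
      have hmn : m < n := by
        by_contra hnm
        have := hx.antitoneOn (Set.mem_univ n) hm (not_lt.mp hnm)
        omega
      have hin := hI i hmn.le hi
      refine ⟨i, hin, ?_⟩
      change ringUpdate (I i) (y i) z n = x n
      rw [ringUpdate_of_occupied hi (him.trans hmz)]
      have h1 := hy i hi hin hmn
      have h2 := hle i hin
      omega
  · rw [ringUpdate_of_ne hz]
    refine ⟨fun i hi => (hle i hi).trans (le_ringUpdate _ _ _ _), j, hj, ?_⟩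
    exact (ringUpdate_of_ne (by rwa [hjn])).trans hjn

lemma IsMinOf.foldl_ringUpdate {ι : Type*} {I : ι → Set ℤ} (hI : ∀ i, IsUpperSet (I i))
    (l : List ℤ) {y : ι → ℤ → ℤ} {x : ℤ → ℤ} (h : IsMinOf I y x)
    (hx : OrderedOn Set.univ x) (hy : ∀ i, OrderedOn (I i) (y i)) :
    IsMinOf I (fun i => l.foldl (ringUpdate (I i)) (y i))
      (l.foldl (ringUpdate Set.univ) x) := by
  induction l generalizing x y with
  | nil => exact h
  | cons z l ih =>
    exact ih (h.step hI hx hy z) (hx.step z) fun i => (hy i).step z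

/-! ### Localisation to finitely many rings -/

/-- `x` and `y` agree on the particles with labels up to `n`, as far as these are at sites in
`(-∞, b]`. -/
def AgreeUpTo (I : Set ℤ) (n b : ℤ) (x y : ℤ → ℤ) : Prop :=
  ∀ m ∈ I, m ≤ n → x m = y m ∨ b < x m ∧ b < y m

lemma AgreeUpTo.symm {I : Set ℤ} {n b : ℤ} {x y : ℤ → ℤ} (h : AgreeUpTo I n b x y) :
    AgreeUpTo I n b y x := fun m hm hmn => (h m hm hmn).imp Eq.symm And.symm

lemma AgreeUpTo.occupied {I : Set ℤ} {n b : ℤ} {x y : ℤ → ℤ} (h : AgreeUpTo I n b x y)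
    (hx : OrderedOn I x) {z m : ℤ} (hz : z < b) (hm : m ∈ I) (hmn : m ≤ n) (hmz : x m = z)
    (ho : ∃ k ∈ I, x k = z + 1) : ∃ k ∈ I, y k = z + 1 := by
  obtain ⟨k, hk, hkz⟩ := ho
  have hkm : k < m := by
    by_contra hmk
    have := hx.antitoneOn hm hk (not_lt.mp hmk)
    omega
  refine ⟨k, hk, ?_⟩
  rcases h k hk (by omega) with h | h <;> omega

/-- For `z < b`, a blocker at `z + 1 ≤ b` has a smaller label and hence is common to both. A ring at
`b` is excluded because `b + 1` may be occupied in only one configuration. -/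
lemma AgreeUpTo.step {I : Set ℤ} {n b : ℤ} {x y : ℤ → ℤ} (h : AgreeUpTo I n b x y)
    (hx : OrderedOn I x) (hy : OrderedOn I y) {z : ℤ} (hz : z ≠ b) :
    AgreeUpTo I n b (ringUpdate I x z) (ringUpdate I y z) := by
  intro m hm hmn
  have h1 := le_ringUpdate I x z m
  have h2 := le_ringUpdate I y z m
  rcases h m hm hmn with h' | h'
  · by_cases hmz : x m = z
    · rcases lt_or_gt_of_ne hz with hzb | hzb
      · left
        by_cases ho : ∃ k ∈ I, x k = z + 1
        · obtain ⟨k', hk', hkz'⟩ := h.occupied hx hzb hm hmn hmz ho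
          obtain ⟨k, hk, hkz⟩ := ho
          rw [ringUpdate_of_occupied hk hkz, ringUpdate_of_occupied hk' hkz', h']
        · have ho' : ¬ ∃ k ∈ I, y k = z + 1 := fun ho' =>
            ho (h.symm.occupied hy hzb hm hmn (h' ▸ hmz) ho')
          push Not at ho ho'
          rw [ringUpdate_of_empty hm hmz ho, ringUpdate_of_empty hm (h' ▸ hmz) ho']
      · right
        omega
    · left
      rw [ringUpdate_of_ne hmz, ringUpdate_of_ne (h' ▸ hmz), h']
  · right
    omega

/-- Labels up to `n` have no particle left of `x n`, and a jump beyond `b` stays beyond `b`; such a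
ring may be dropped. -/
lemma AgreeUpTo.step_left {I : Set ℤ} {n b : ℤ} {x y : ℤ → ℤ} (h : AgreeUpTo I n b x y)
    (hn : n ∈ I) (hx : OrderedOn I x) {z : ℤ} (hz : z < x n ∨ b < z) :
    AgreeUpTo I n b (ringUpdate I x z) y := by
  intro m hm hmn
  have h1 := le_ringUpdate I x z m
  have h2 := hx.antitoneOn hm hn hmn
  by_cases hmz : x m = z
  · rcases h m hm hmn with h' | h' <;> omega
  · rw [ringUpdate_of_ne hmz]
    exact h m hm hmn

lemma ringUpdate_le_of_ne {I : Set ℤ} {x : ℤ → ℤ} {n b z : ℤ} (h : x n ≤ b) (hz : z ≠ b) :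
    ringUpdate I x z n ≤ b := by
  unfold ringUpdate
  split_ifs <;> omega

lemma foldl_ringUpdate_filter {I : Set ℤ} {n a b : ℤ} (hn : n ∈ I) (l : List ℤ) (hb : b ∉ l)
    {x y : ℤ → ℤ} (hx : OrderedOn I x) (hy : OrderedOn I y) (hxy : AgreeUpTo I n b x y)
    (ha : a ≤ x n) (hxb : x n ≤ b) :
    l.foldl (ringUpdate I) x n =
      (l.filter (fun z => decide (a ≤ z ∧ z ≤ b))).foldl (ringUpdate I) y n := by
  induction l generalizing x y with
  | nil =>
    rcases hxy n hn le_rfl with h | h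
    · exact h
    · omega
  | cons z l ih =>
    have hzb : z ≠ b := fun h => hb (h ▸ List.mem_cons_self)
    have hbl : b ∉ l := fun h => hb (List.mem_cons_of_mem _ h)
    have hxa := ha.trans (le_ringUpdate I x z n)
    have hxb' := ringUpdate_le_of_ne (I := I) hxb hzb
    by_cases hz : a ≤ z ∧ z ≤ b
    · rw [List.filter_cons_of_pos (by simpa using hz)]
      exact ih hbl (hx.step z) (hy.step z) (hxy.step hx hy hzb) hxa hxb'
    · rw [List.filter_cons_of_neg (by simpa using hz)]
      exact ih hbl (hx.step z) hy (hxy.step_left hn hx (by omega)) hxa hxb'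

lemma Finset.sort_filter_eq {α : Type*} [LinearOrder α] (s : Finset α) (p : α → Prop)
    [DecidablePred p] :
    (s.filter p).sort (· ≤ ·) = (s.sort (· ≤ ·)).filter (fun x => decide (p x)) := by
  refine List.Perm.eq_of_pairwise (le := (· ≤ ·)) (fun a b _ _ h h' => le_antisymm h h')
    (Finset.pairwise_sort _ _) ((Finset.pairwise_sort _ _).filter _) ?_
  refine (List.perm_ext_iff_of_nodup (Finset.sort_nodup _ _)
    ((Finset.sort_nodup _ _).filter _)).mpr fun a => ?_
  simp

/-- The properties of a realisation of the clocks that make the graphical construction work. -/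
structure GoodClocks (e : ℤ → ℕ → ℝ) : Prop where
  nonneg : ∀ z k, 0 ≤ e z k
  tendsto : ∀ z, Tendsto (ringTime e z) atTop atTop
  exists_quiet : ∀ (t : ℝ) (a : ℤ), ∃ b, a ≤ b ∧ t < e b 0

lemma mem_ringsUpTo {e : ℤ → ℕ → ℝ} {L : ℕ} {t : ℝ} {r : ℝ ×ₗ ℤ} :
    r ∈ ringsUpTo e L t ↔ ∃ z : ℤ, ∃ k : ℕ, (-(L : ℤ) ≤ z ∧ z ≤ L) ∧ k < L ∧
      ringTime e z k ≤ t ∧ toLex (ringTime e z k, z) = r := by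
  simp only [ringsUpTo, Finset.mem_image, Finset.mem_filter, Finset.mem_product, Finset.mem_Icc,
    Finset.mem_range, Prod.exists, and_assoc]

lemma GoodClocks.eventually_filter_ringsUpTo {e : ℤ → ℕ → ℝ} (he : GoodClocks e) (t : ℝ)
    (a b : ℤ) : ∃ L₀ : ℕ, ∀ L ≥ L₀,
      (ringsUpTo e L t).filter (fun r => a ≤ (ofLex r).2 ∧ (ofLex r).2 ≤ b) =
        (ringsUpTo e L₀ t).filter (fun r => a ≤ (ofLex r).2 ∧ (ofLex r).2 ≤ b) := by
  have h1 : ∀ᶠ k in atTop, ∀ z ∈ Finset.Icc a b, t < ringTime e z k :=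
    (Filter.eventually_all_finset _).mpr fun z _ => (he.tendsto z).eventually_gt_atTop t
  obtain ⟨K, hK⟩ := eventually_atTop.mp h1
  -- Rings with index at least `K` at sites of `[a, b]` come after `t`; the other bounds make `[-L,
  -- L]` contain `[a, b]`.
  refine ⟨max K (max a.natAbs b.natAbs), fun L hL => ?_⟩
  ext r
  simp only [Finset.mem_filter, mem_ringsUpTo]
  refine and_congr_left fun hr => ?_
  constructor
  · rintro ⟨z, k, hz, hk, ht, rfl⟩
    simp only [ofLex_toLex] at hr
    refine ⟨z, k, by omega, ?_, ht, rfl⟩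
    by_contra hkK
    exact absurd (hK k (by omega) z (Finset.mem_Icc.mpr hr)) (not_lt.mpr ht)
  · rintro ⟨z, k, hz, hk, ht, rfl⟩
    exact ⟨z, k, by omega, by omega, ht, rfl⟩

lemma GoodClocks.tasepWellDefined {e : ℤ → ℕ → ℝ} (he : GoodClocks e) {I : Set ℤ} {x₀ : ℤ → ℤ}
    (hx : OrderedOn I x₀) : TasepWellDefined e I x₀ := by
  intro t _ n hn
  obtain ⟨b, hab, hb⟩ := he.exists_quiet t (x₀ n)
  obtain ⟨L₀, hL₀⟩ := he.eventually_filter_ringsUpTo t (x₀ n) b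
  have hlocal : ∀ L, tasepApprox e I x₀ L t n =
      ((((ringsUpTo e L t).filter (fun r => x₀ n ≤ (ofLex r).2 ∧ (ofLex r).2 ≤ b)).sort
        (· ≤ ·)).map (fun r => (ofLex r).2)).foldl (ringUpdate I) x₀ n := by
    intro L
    rw [tasepApprox, foldl_ringUpdate_filter (a := x₀ n) (b := b) hn _ _ hx hx
      (fun m _ _ => Or.inl rfl) le_rfl hab, List.filter_map, Finset.sort_filter_eq]
    · rfl
    · simp only [List.mem_map, Finset.mem_sort, mem_ringsUpTo]
      rintro ⟨_, ⟨z, k, -, -, ht, rfl⟩, hz⟩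
      obtain rfl : z = b := hz
      have : e z 0 ≤ ringTime e z k :=
        Finset.single_le_sum (f := e z) (fun i _ => he.nonneg z i)
          (Finset.mem_range.mpr k.succ_pos)
      linarith
  have hconst : ∀ᶠ L in atTop, tasepApprox e I x₀ L t n = tasepApprox e I x₀ L₀ t n := by
    filter_upwards [eventually_ge_atTop L₀] with L hL
    rw [hlocal, hlocal, hL₀ L hL]
  have hlim : tasep e I x₀ n t = tasepApprox e I x₀ L₀ t n :=
    (tendsto_const_nhds.congr' (hconst.mono fun _ h => h.symm)).limUnder_eq
  rwa [hlim]

/-- With finitely many systems, one `L` gives the exact positions of particle `n` in all of them, so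
the finite induction applies. -/
lemma tasep_isMinOf {e : ℤ → ℕ → ℝ} (he : GoodClocks e) {ι : Type*} [Finite ι] {I : ι → Set ℤ}
    (hI : ∀ i, IsUpperSet (I i)) {y : ι → ℤ → ℤ} {x : ℤ → ℤ} (h : IsMinOf I y x)
    (hx : OrderedOn Set.univ x) (hy : ∀ i, OrderedOn (I i) (y i)) {t : ℝ} (ht : 0 ≤ t) :
    IsMinOf I (fun i n => tasep e (I i) (y i) n t) (fun n => tasep e Set.univ x n t) := by
  intro n
  have h1 := he.tasepWellDefined hx t ht n (Set.mem_univ n)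
  have h2 : ∀ᶠ L in atTop, ∀ i, n ∈ I i →
      tasepApprox e (I i) (y i) L t n = tasep e (I i) (y i) n t :=
    eventually_all.mpr fun i => eventually_imp_distrib_left.mpr
      fun hi => he.tasepWellDefined (hy i) t ht n hi
  obtain ⟨L, hL1, hL2⟩ := (h1.and h2).exists
  obtain ⟨hle, i, hi, hin⟩ := h.foldl_ringUpdate hI
    (((ringsUpTo e L t).sort (· ≤ ·)).map (fun r => (ofLex r).2)) hx hy n
  refine ⟨fun i hi => ?_, i, hi, ?_⟩
  · change tasep e Set.univ x n t ≤ tasep e (I i) (y i) n t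
    rw [← hL1, ← hL2 i hi]
    exact hle i hi
  · change tasep e (I i) (y i) n t = tasep e Set.univ x n t
    rw [← hL1, ← hL2 i hi]
    exact hin

/-! ### Almost sure properties of Poisson clocks -/

lemma expMeasure_Iic_lt_one (c : ℝ) : expMeasure 1 (Set.Iic c) < 1 := by
  have := isProbabilityMeasure_expMeasure (r := 1) one_pos
  rw [← ofReal_cdf, cdf_expMeasure_eq one_pos, ← ENNReal.ofReal_one,
    ENNReal.ofReal_lt_ofReal_iff one_pos]
  split_ifs
  · linarith [Real.exp_pos (-(1 * c))]
  · exact one_pos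

/-- The chance that `k` successive variables are all at most `c` is a `k`-th power of a number below
one. -/
lemma ae_exists_ge_lt_of_iIndepFun {Ω : Type*} [MeasurableSpace Ω] {P : Measure Ω}
    {X : ℕ → Ω → ℝ} (hlaw : ∀ n, HasLaw (X n) (expMeasure 1) P) (hind : iIndepFun X P)
    (c : ℝ) (m : ℕ) : ∀ᵐ ω ∂P, ∃ n ≥ m, c < X n ω := by
  rw [ae_iff]
  refine le_antisymm (ge_of_tendsto' (ENNReal.tendsto_pow_atTop_nhds_zero_of_lt_one
    (expMeasure_Iic_lt_one c)) fun k => ?_) zero_le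
  calc P {ω | ¬∃ n ≥ m, c < X n ω}
      ≤ P (⋂ n ∈ Finset.Ico m (m + k), X n ⁻¹' Set.Iic c) := by
        refine measure_mono fun ω hω => ?_
        simp only [Set.mem_ofPred_eq, not_exists, not_and, not_lt] at hω
        simp only [Set.mem_iInter, Finset.mem_Ico]
        exact fun n hn => hω n hn.1
    _ = ∏ n ∈ Finset.Ico m (m + k), P (X n ⁻¹' Set.Iic c) :=
        hind.measure_inter_preimage_eq_mul _ fun _ _ => measurableSet_Iic
    _ = expMeasure 1 (Set.Iic c) ^ k := by
        rw [Finset.prod_congr rfl fun n _ => by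
          rw [← Measure.map_apply_of_aemeasurable (hlaw n).aemeasurable measurableSet_Iic,
            (hlaw n).map_eq]]
        simp

lemma tendsto_sum_range_succ_atTop {f : ℕ → ℝ} (h0 : ∀ k, 0 ≤ f k)
    (h1 : ∀ m, ∃ n ≥ m, 1 < f n) :
    Tendsto (fun k => ∑ i ∈ Finset.range (k + 1), f i) atTop atTop := by
  have hmono : Monotone fun k => ∑ i ∈ Finset.range (k + 1), f i := fun k l hkl =>
    Finset.sum_le_sum_of_subset_of_nonneg (Finset.range_mono (by omega)) fun i _ _ => h0 i
  have hnat : ∀ N : ℕ, ∃ k, (N : ℝ) ≤ ∑ i ∈ Finset.range (k + 1), f i := by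
    intro N
    induction N with
    | zero => exact ⟨0, by simpa using h0 0⟩
    | succ N ih =>
      obtain ⟨k, hk⟩ := ih
      obtain ⟨n, hn, hfn⟩ := h1 (k + 1)
      refine ⟨n, ?_⟩
      rw [Finset.sum_range_succ]
      obtain ⟨j, rfl⟩ : ∃ j, n = j + 1 := ⟨n - 1, by omega⟩
      have : ∑ i ∈ Finset.range (k + 1), f i ≤ ∑ i ∈ Finset.range (j + 1), f i :=
        hmono (by omega)
      push_cast
      linarith
  refine tendsto_atTop_atTop_of_monotone hmono fun b => ?_
  obtain ⟨N, hN⟩ := exists_nat_ge b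
  obtain ⟨k, hk⟩ := hnat N
  exact ⟨k, hN.trans hk⟩

lemma IsPoissonClocks.ae_goodClocks {Ω : Type*} [MeasurableSpace Ω] {P : Measure Ω}
    {E : ℤ → ℕ → Ω → ℝ} (hE : IsPoissonClocks P E) :
    ∀ᵐ ω ∂P, GoodClocks (fun z k => E z k ω) := by
  have hnonneg : ∀ᵐ ω ∂P, ∀ z k, 0 ≤ E z k ω := by
    refine ae_all_iff.mpr fun z => ae_all_iff.mpr fun k => ?_
    have := isProbabilityMeasure_expMeasure (r := 1) one_pos
    have h0 : expMeasure 1 (Set.Iic 0) = 0 := by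
      rw [← ofReal_cdf, cdf_expMeasure_eq one_pos]
      simp
    have h1 : P (E z k ⁻¹' Set.Iic 0) = 0 := by
      rw [← Measure.map_apply_of_aemeasurable (hE.hasLaw z k).aemeasurable measurableSet_Iic,
        (hE.hasLaw z k).map_eq, h0]
    refine ae_iff.mpr (measure_mono_null (fun ω hω => ?_) h1)
    exact (not_le.mp hω).le
  have hlong : ∀ᵐ ω ∂P, ∀ z : ℤ, ∀ m : ℕ, ∃ n ≥ m, 1 < E z n ω := by
    refine ae_all_iff.mpr fun z => ae_all_iff.mpr fun m => ?_
    exact ae_exists_ge_lt_of_iIndepFun (fun n => hE.hasLaw z n)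
      (hE.indep.precomp (g := fun n : ℕ => (z, n)) fun _ _ h => (Prod.ext_iff.mp h).2) 1 m
  -- Integer thresholds `c` keep the null sets countable and suffice for all real times.
  have hquiet : ∀ᵐ ω ∂P, ∀ c m : ℕ, ∃ n ≥ m, (c : ℝ) < E (n : ℤ) 0 ω := by
    refine ae_all_iff.mpr fun c => ae_all_iff.mpr fun m => ?_
    exact ae_exists_ge_lt_of_iIndepFun (X := fun n : ℕ => E (n : ℤ) 0)
      (fun n => hE.hasLaw n 0)
      (hE.indep.precomp (g := fun n : ℕ => ((n : ℤ), 0))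
        fun _ _ h => Nat.cast_injective (Prod.ext_iff.mp h).1) c m
  filter_upwards [hnonneg, hlong, hquiet] with ω h1 h2 h3
  refine ⟨h1, fun z => tendsto_sum_range_succ_atTop (h1 z) (h2 z), fun t a => ?_⟩
  obtain ⟨c, hc⟩ := exists_nat_ge t
  obtain ⟨n, hn, hcn⟩ := h3 c a.toNat
  exact ⟨n, by omega, hc.trans_lt hcn⟩

/-! ### The initial conditions -/

lemma floor_div_add_le {ρ : ℝ} (h0 : 0 < ρ) (h1 : ρ < 1) {m n : ℤ} (h : m ≤ n) :
    ⌊(m : ℝ) / ρ⌋ + (n - m) ≤ ⌊(n : ℝ) / ρ⌋ := by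
  rw [← Int.floor_add_intCast]
  refine Int.floor_le_floor ?_
  have hmn : (0 : ℝ) ≤ n - m := by exact_mod_cast sub_nonneg.mpr h
  have : ((n : ℝ) - m) ≤ (n - m) / ρ := le_div_self hmn h0 h1.le
  rw [sub_div] at this
  push_cast
  linarith

lemma floor_div_le_of_nonpos {ρ : ℝ} (h0 : 0 < ρ) (h1 : ρ < 1) {n : ℤ} (h : n ≤ 0) :
    ⌊(n : ℝ) / ρ⌋ ≤ n := by
  have := floor_div_add_le h0 h1 h
  simp at this
  omega

lemma le_floor_div_of_nonneg {ρ : ℝ} (h0 : 0 < ρ) (h1 : ρ < 1) {n : ℤ} (h : 0 ≤ n) :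
    n ≤ ⌊(n : ℝ) / ρ⌋ := by
  have := floor_div_add_le h0 h1 h
  simp at this
  omega

lemma midCount_nonneg {ρ : ℝ} (h0 : 0 < ρ) (T : ℕ) : 0 ≤ midCount ρ T :=
  Int.floor_nonneg.mpr (by positivity)

/-- Particle `-M` starts at or left of `T`, so the middle block fits below the right one. -/
lemma neg_le_floor_neg_midCount_div {ρ : ℝ} (h0 : 0 < ρ) (T : ℕ) :
    -(T : ℤ) ≤ ⌊((-midCount ρ T : ℤ) : ℝ) / ρ⌋ := by
  rw [Int.le_floor, le_div_iff₀ h0]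
  have : (midCount ρ T : ℝ) ≤ T * ρ := Int.floor_le _
  push_cast
  linarith

lemma orderedOn_threeDensityInit {ρ₁ ρ₂ ρ₃ : ℝ} (h₁ : 0 < ρ₁) (h₁' : ρ₁ < 1) (h₂ : 0 < ρ₂)
    (h₂' : ρ₂ < 1) (h₃ : 0 < ρ₃) (h₃' : ρ₃ < 1) (T : ℕ) :
    OrderedOn Set.univ (threeDensityInit ρ₁ ρ₂ ρ₃ T) := by
  intro m _ n _ hmn
  have hM := midCount_nonneg h₂ T
  have hT := neg_le_floor_neg_midCount_div h₂ T
  unfold threeDensityInit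
  have f₁ := floor_div_add_le h₁ h₁' hmn.le
  have f₂ := floor_div_add_le h₂ h₂' hmn.le
  have f₃ := floor_div_add_le h₃ h₃' (add_le_add_left hmn.le (midCount ρ₂ T))
  have g₁ := fun h => le_floor_div_of_nonneg h₁ h₁' (n := n) h
  have g₂ := fun h => floor_div_le_of_nonpos h₂ h₂' (n := m) h
  have g₃ := fun h => floor_div_le_of_nonpos h₃ h₃' (n := m + midCount ρ₂ T) h
  have g₄ := fun h => floor_div_add_le h₂ h₂' (m := -midCount ρ₂ T) (n := n) h
  split_ifs <;> omega

lemma orderedOn_init₁ {ρ : ℝ} (h0 : 0 < ρ) (h1 : ρ < 1) (I : Set ℤ) :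
    OrderedOn I (init₁ ρ) := by
  intro m _ n _ hmn
  have := floor_div_add_le h0 h1 hmn.le
  unfold init₁
  omega

lemma orderedOn_init₂ {ρ : ℝ} (h0 : 0 < ρ) (h1 : ρ < 1) (I : Set ℤ) :
    OrderedOn I (init₂ ρ) := by
  intro m _ n _ hmn
  have h2 := floor_div_add_le h0 h1 hmn.le
  have h3 := fun h => floor_div_le_of_nonpos (n := m) h0 h1 h
  unfold init₂
  split_ifs <;> omega

lemma orderedOn_init₃ (ρ₂ : ℝ) {ρ₃ : ℝ} (h0 : 0 < ρ₃) (h1 : ρ₃ < 1) (T : ℕ) (I : Set ℤ) :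
    OrderedOn I (init₃ ρ₂ ρ₃ T) := by
  intro m _ n _ hmn
  have h2 := floor_div_add_le h0 h1 (add_le_add_left hmn.le (midCount ρ₂ T))
  have h3 := fun h => floor_div_le_of_nonpos (n := m + midCount ρ₂ T) h0 h1 h
  unfold init₃
  split_ifs <;> omega

/-! ### The three subproblems and the conclusion -/

/-- The labels of the three subproblems; `M` is the number of particles in the middle part. -/
def subLabels (M : ℤ) : Fin 3 → Set ℤ := ![Set.Ici 0, Set.Ici (-M), Set.univ]

/-- The initial conditions of the three subproblems. -/
noncomputable def subInit (ρ₁ ρ₂ ρ₃ : ℝ) (T : ℕ) : Fin 3 → ℤ → ℤ :=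
  ![init₁ ρ₁, init₂ ρ₂, init₃ ρ₂ ρ₃ T]

lemma isMinOf_threeDensityInit {ρ₁ ρ₂ ρ₃ : ℝ} (h₁ : 0 < ρ₁) (h₁' : ρ₁ < 1) (h₂ : 0 < ρ₂)
    (h₂' : ρ₂ < 1) (T : ℕ) :
    IsMinOf (subLabels (midCount ρ₂ T)) (subInit ρ₁ ρ₂ ρ₃ T) (threeDensityInit ρ₁ ρ₂ ρ₃ T) := by
  intro n
  have hM := midCount_nonneg h₂ T
  have hT := neg_le_floor_neg_midCount_div h₂ T
  have hMT := floor_div_le_of_nonpos h₂ h₂' (neg_nonpos.mpr hM)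
  -- Spacing at least one, counted from particle `-M` at or left of `T`, keeps the middle block
  -- below the step in `init₃`; `hT` and `hMT` give `M ≤ T`, which does the same for labels `n ≥ 0`.
  have hmid := fun h => floor_div_add_le h₂ h₂' (m := -midCount ρ₂ T) (n := n) h
  have hleft := fun h => le_floor_div_of_nonneg h₁ h₁' (n := n) h
  have hx : threeDensityInit ρ₁ ρ₂ ρ₃ T n = if 0 ≤ n then init₁ ρ₁ n
      else if -midCount ρ₂ T ≤ n then init₂ ρ₂ n else init₃ ρ₂ ρ₃ T n := by
    unfold threeDensityInit init₁ init₂ init₃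
    split_ifs <;> rfl
  rw [hx]
  constructor
  · intro i
    fin_cases i
    · intro (hi : 0 ≤ n)
      exact (if_pos hi).le
    · intro (hi : -midCount ρ₂ T ≤ n)
      change _ ≤ init₂ ρ₂ n
      unfold init₁ init₂
      split_ifs <;> omega
    · intro _
      change _ ≤ init₃ ρ₂ ρ₃ T n
      unfold init₁ init₂ init₃
      split_ifs <;> omega
  · by_cases c1 : 0 ≤ n
    · exact ⟨0, c1, (if_pos c1).symm⟩
    · rw [if_neg c1]
      by_cases c2 : -midCount ρ₂ T ≤ n
      · exact ⟨1, c2, (if_pos c2).symm⟩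
      · exact ⟨2, Set.mem_univ n, (if_neg c2).symm⟩

theorem proposition3p1 {Ω : Type*} [MeasurableSpace Ω] (P : Measure Ω) [IsProbabilityMeasure P]
    (E : ℤ → ℕ → Ω → ℝ) (hE : IsPoissonClocks P E)
    (ρ₁ ρ₂ ρ₃ : ℝ) (h₁ : 0 < ρ₁) (h₁₂ : ρ₁ < ρ₂) (h₂₃ : ρ₂ < ρ₃) (h₃ : ρ₃ < 1) (T : ℕ) :
    ∀ᵐ ω ∂P,
      TasepWellDefined (fun z k => E z k ω) Set.univ (threeDensityInit ρ₁ ρ₂ ρ₃ T) ∧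
      TasepWellDefined (fun z k => E z k ω) (Set.Ici 0) (init₁ ρ₁) ∧
      TasepWellDefined (fun z k => E z k ω) (Set.Ici (-midCount ρ₂ T)) (init₂ ρ₂) ∧
      TasepWellDefined (fun z k => E z k ω) Set.univ (init₃ ρ₂ ρ₃ T) ∧
      ∀ t : ℝ, 0 ≤ t → ∀ N : ℤ, 0 < N →
        tasep (fun z k => E z k ω) Set.univ (threeDensityInit ρ₁ ρ₂ ρ₃ T) N t =
          min (tasep (fun z k => E z k ω) (Set.Ici 0) (init₁ ρ₁) N t)
            (min (tasep (fun z k => E z k ω) (Set.Ici (-midCount ρ₂ T)) (init₂ ρ₂) N t)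
              (tasep (fun z k => E z k ω) Set.univ (init₃ ρ₂ ρ₃ T) N t)) := by
  have h₂ : 0 < ρ₂ := h₁.trans h₁₂
  have h₂' : ρ₂ < 1 := h₂₃.trans h₃
  have h₁' : ρ₁ < 1 := h₁₂.trans h₂'
  have h₃' : 0 < ρ₃ := h₂.trans h₂₃
  have hx := orderedOn_threeDensityInit h₁ h₁' h₂ h₂' h₃' h₃ T
  have hx₁ := orderedOn_init₁ h₁ h₁' (Set.Ici 0)
  have hx₂ := orderedOn_init₂ h₂ h₂' (Set.Ici (-midCount ρ₂ T))
  have hx₃ := orderedOn_init₃ ρ₂ h₃' h₃ T Set.univ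
  have hM := midCount_nonneg h₂ T
  filter_upwards [hE.ae_goodClocks] with ω he
  refine ⟨he.tasepWellDefined hx, he.tasepWellDefined hx₁, he.tasepWellDefined hx₂,
    he.tasepWellDefined hx₃, fun t ht N hN => ?_⟩
  have hI : ∀ i, IsUpperSet (subLabels (midCount ρ₂ T) i) := by
    intro i
    fin_cases i
    · exact isUpperSet_Ici _
    · exact isUpperSet_Ici _
    · exact isUpperSet_univ
  have hy : ∀ i, OrderedOn (subLabels (midCount ρ₂ T) i) (subInit ρ₁ ρ₂ ρ₃ T i) := by
    intro i
    fin_cases i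
    · exact hx₁
    · exact hx₂
    · exact hx₃
  obtain ⟨hle, i, -, hi⟩ :=
    tasep_isMinOf he hI (isMinOf_threeDensityInit h₁ h₁' h₂ h₂' T) hx hy ht N
  -- For `N > 0` the label is present in all three systems, so all three bounds count.
  have hle₁ := hle 0 hN.le
  have hle₂ := hle 1 (show -midCount ρ₂ T ≤ N by omega)
  have hle₃ := hle 2 (Set.mem_univ N)
  refine le_antisymm (le_min hle₁ (le_min hle₂ hle₃)) ?_
  refine le_trans ?_ hi.le
  fin_cases i
  · exact min_le_left _ _
  · exact (min_le_right _ _).trans (min_le_left _ _)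
  · exact (min_le_right _ _).trans (min_le_right _ _)
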